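/- Let $g\ge 2$ and let $\mathcal H_g$ be the Siegel upper half-space of complex symmetric $g\times g$ matrices with positive definite imaginary part. For $\varepsilon,\delta\in\mathbb F_2^g$ (lifted to $\{0,1\}^g$), $\tau\in\mathcal H_g$ and $z\in\mathbb C^g$ let $$\theta_{[\varepsilon,\delta]}(\tau,z)=\sum_{p\in\mathbb Z^g}\exp\Big(\pi i\big[(p+\tfrac{\varepsilon}{2})^t\tau(p+\tfrac{\varepsilon}{2})+2(p+\tfrac{\varepsilon}{2})^t(z+\tfrac{\delta}{2})\big]\Big),\qquad \Theta[\sigma](\tau,z)=\theta_{[\sigma,0]}(2\tau,2z).$$ The characteristic $[\varepsilon,\delta]$ is called odd if $\varepsilon\cdot\delta=1\in\mathbb F_2$, and $v_m(\tau)=\operatorname{grad}_z\theta_m(\tau,z)|_{z=0}\in\mathbb C^g$ for $m$ odd. For distinct odd characteristics $m_1,\dots,m_{g-1}$ let $F=(F_1,\dots,F_g)=v_{m_1}(\tau)\wedge\dots\wedge v_{m_{g-1}}(\tau)$, where $F_i$ is the determinant of the matrix with rows $v_{m_1}(\tau),\dots,v_{m_{g-1}}(\tau),e_i$ (so $v_{m_1}\wedge\dots\wedge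 v_{m_{g-1}}\wedge e_i=F_i\,e_1\wedge\dots\wedge e_g$), and let $$W(m_1,\dots,m_{g-1})(\tau)=\pi^{-2g+2}\,F^tF=\pi^{-2g+2}\,(F_iF_j)_{i,j},$$ which does not depend on the order of the $m_j$. For $\varepsilon,\delta\in\mathbb F_2^g$ let $A_{\varepsilon\delta}(\tau)$ be the symmetric $g\times g$ matrix with entries $$A_{\varepsilon\delta,ij}(\tau)=\big(\partial_{z_i}\partial_{z_j}\Theta[\delta]\big)(\tau,0)\,\Theta[\varepsilon](\tau,0)-\big(\partial_{z_i}\partial_{z_j}\Theta[\varepsilon]\big)(\tau,0)\,\Theta[\delta](\tau,0),$$ and let $A^{ad}_{\varepsilon\delta}$ be its adjugate, the transpose of the matrix of cofactors. Then for all $\varepsilon\ne\delta$ in $\mathbb F_2^g$ and all $\tau\in\mathcal H_g$ $$A^{ad}_{\varepsilon\delta}(\tau)=\Big(\frac{\pi^2}{2^{g-2}}\Big)^{g-1}\sum_{\{\alpha_1,\dots,\alpha_{g-1}\}}(-1)^{\delta\cdot(\alpha_1+\dots+\alpha_{g-1})}\,W\big([\varepsilon+\delta,\alpha_1],\dots,[\varepsilon+\delta,\alpha_{g-1}]\big)(\tau),$$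 where the sum runs over all sets of $g-1$ distinct elements $\alpha_1,\dots,\alpha_{g-1}\in\mathbb F_2^g$ such that every $[\varepsilon+\delta,\alpha_j]$ is odd (each unordered set is counted once). -/

import Mathlib

open scoped Matrix

noncomputable section

namespace ThetaGradients

/-- The Siegel upper half-space: complex symmetric `g × g` matrices with positive definite
imaginary part. -/
def siegelUpperHalfSpace (g : ℕ) : Set (Matrix (Fin g) (Fin g) ℂ) :=
  {τ | τ.IsSymm ∧ (τ.map Complex.im).PosDef}

/-- `𝔽₂^g`. -/
abbrev F2 (g : ℕ) : Type := Fin g → ZMod 2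

/-- A theta characteristic `[ε, δ]` with `ε, δ ∈ 𝔽₂^g`. -/
abbrev Characteristic (g : ℕ) : Type := F2 g × F2 g

/-- `[ε, δ]` is odd if `ε · δ = 1` in `𝔽₂`. -/
abbrev Characteristic.IsOdd {g : ℕ} (m : Characteristic g) : Prop := m.1 ⬝ᵥ m.2 = 1

/-- The vector `ε / 2 ∈ ℂ^g`, where `ε ∈ 𝔽₂^g` is lifted to `{0, 1}^g`. -/
def half {g : ℕ} (ε : F2 g) : Fin g → ℂ := fun i => ((ε i).val : ℂ) / 2

/-- The theta function with characteristic `m = [ε, δ]`: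
`∑_{p ∈ ℤ^g} exp (π i [(p + ε/2)ᵗ τ (p + ε/2) + 2 (p + ε/2)ᵗ (z + δ/2)])`. -/
def theta {g : ℕ} (m : Characteristic g) (τ : Matrix (Fin g) (Fin g) ℂ) (z : Fin g → ℂ) : ℂ :=
  ∑' p : Fin g → ℤ,
    let u : Fin g → ℂ := (fun i => (p i : ℂ)) + half m.1
    Complex.exp (Real.pi * Complex.I * (u ⬝ᵥ (τ *ᵥ u) + 2 * (u ⬝ᵥ (z + half m.2))))

/-- The second order theta function `Θ[σ](τ, z) = θ[σ, 0](2τ, 2z)`. -/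
def theta2 {g : ℕ} (σ : F2 g) (τ : Matrix (Fin g) (Fin g) ℂ) (z : Fin g → ℂ) : ℂ :=
  theta (σ, 0) ((2 : ℂ) • τ) ((2 : ℂ) • z)

/-- The partial derivative `∂f/∂z_i` of a function on `ℂ^g`. -/
def partialZ {g : ℕ} (i : Fin g) (f : (Fin g → ℂ) → ℂ) : (Fin g → ℂ) → ℂ :=
  fun z => lineDeriv ℂ f z (Pi.single i 1)

/-- The gradient `v_m(τ) = grad_z θ_m(τ, z)` at `z = 0`. -/
def thetaGrad {g : ℕ} (m : Characteristic g) (τ : Matrix (Fin g) (Fin g) ℂ) : Fin g → ℂ :=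
  fun i => partialZ i (theta m τ) 0

/-- The matrix `A_{εδ}(τ)` with entries
`(∂_{z_i} ∂_{z_j} Θ[δ]) Θ[ε] - (∂_{z_i} ∂_{z_j} Θ[ε]) Θ[δ]`, evaluated at `z = 0`. -/
def matA {g : ℕ} (ε δ : F2 g) (τ : Matrix (Fin g) (Fin g) ℂ) : Matrix (Fin g) (Fin g) ℂ :=
  Matrix.of fun i j =>
    partialZ i (partialZ j (theta2 δ τ)) 0 * theta2 ε τ 0
      - partialZ i (partialZ j (theta2 ε τ)) 0 * theta2 δ τ 0

/-- The wedge product `v_1 ∧ ⋯ ∧ v_{g-1}` of vectors of `ℂ^g`, as a vector of `ℂ^g` under the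
usual identification of `⋀^{g-1} ℂ^g` with (the dual of) `ℂ^g`: its `i`-th coordinate `F_i` is
given by `v_1 ∧ ⋯ ∧ v_{g-1} ∧ e_i = F_i • (e_1 ∧ ⋯ ∧ e_g)`, that is, `F_i` is the determinant
of the matrix with rows `v_1, …, v_{g-1}, e_i`. -/
def wedge {g : ℕ} (v : Fin (g - 1) → Fin g → ℂ) : Fin g → ℂ :=
  fun i => Matrix.det (Matrix.of fun r : Fin g =>
    if h : (r : ℕ) < g - 1 then v ⟨r, h⟩ else Pi.single i 1)

/-- `F(m_1, …, m_{g-1})(τ) = v_{m_1}(τ) ∧ ⋯ ∧ v_{m_{g-1}}(τ)`. -/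
def formF {g : ℕ} (m : Fin (g - 1) → Characteristic g) (τ : Matrix (Fin g) (Fin g) ℂ) :
    Fin g → ℂ :=
  wedge fun j => thetaGrad (m j) τ

/-- `W(m_1, …, m_{g-1})(τ) = π^{-2g+2} Fᵗ F`, where the row vector `F` is
`F(m_1, …, m_{g-1})(τ)`; its `(i, j)` entry is `π^{-2g+2} F_i F_j`. It does not depend on the
order of `m_1, …, m_{g-1}`. -/
def formW {g : ℕ} (m : Fin (g - 1) → Characteristic g) (τ : Matrix (Fin g) (Fin g) ℂ) :
    Matrix (Fin g) (Fin g) ℂ :=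
  (Real.pi : ℂ) ^ (-2 * (g : ℤ) + 2) • Matrix.vecMulVec (formF m τ) (formF m τ)

/-- The sign `(-1)^x` for `x ∈ 𝔽₂`. -/
def sign2 (x : ZMod 2) : ℂ := (-1) ^ x.val

end ThetaGradients

end

noncomputable section

namespace ThetaGradients

/-! ### The Cauchy–Binet formula and adjugates of sums of squares -/

/-! Riemann's addition formula (`theta_mul_self`) writes `θ[η,α](x)²` as `∑_ρ (-1)^{ρ·α} Θ[ρ+η](0)
Θ[ρ](x)`. An odd theta function vanishes at `0`, so the Hessian of its square there is twice the
rank one matrix `v vᵗ` of its gradient `v`. Applied to the right side, this expresses `v vᵗ` by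
second derivatives and values of the `Θ[ρ]`. Orthogonality of the characters `α ↦ (-1)^{β·α}`
inverts these relations (`matA_eq_sum_vecMulVec`): with `η = ε + δ`, `A_{εδ} = (4/2^g) ∑ (-1)^{δ·α}
v vᵗ` over the `α` with `[η,α]` odd. The entries of the adjugate are minors of size `g - 1` of this
weighted Gram matrix. Cauchy–Binet (`adjugate_sum_smul_vecMulVec`) turns them into sums over
`(g-1)`-element sets of gradients, whose maximal minors are the coordinates of the wedge. -/

theorem det_mul_eq_sum_prod_mul_det {n ι R : Type*} [Fintype n] [DecidableEq n] [Fintype ι]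
    [CommRing R] (M : Matrix n ι R) (N : Matrix ι n R) :
    (M * N).det = ∑ f : n → ι, (∏ i, M i (f i)) * (N.submatrix f id).det := by
  classical
  have h : (M * N) = fun i => ∑ k, M i k • N k := by
    ext i j
    simp [Matrix.mul_apply, Finset.sum_apply]
  rw [h]
  refine (MultilinearMap.map_sum (Matrix.detRowAlternating (n := n) (R := R)).toMultilinearMap
    (fun i k => M i k • N k)).trans (Finset.sum_congr rfl fun f _ => ?_)
  rw [MultilinearMap.map_smul_univ, smul_eq_mul]
  rfl

/-- The Cauchy–Binet formula. The `n`-element subsets of the inner index type are listed by the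
families that increase with respect to an injective map `key` to a linear order. -/
theorem det_mul_eq_sum_strictMono {n : ℕ} {ι κ R : Type*} [Fintype ι] [LinearOrder κ]
    [CommRing R] {key : ι → κ} (hkey : Function.Injective key)
    (M : Matrix (Fin n) ι R) (N : Matrix ι (Fin n) R)
    [DecidablePred fun f : Fin n → ι => StrictMono (key ∘ f)] :
    (M * N).det = ∑ f : Fin n → ι with StrictMono (key ∘ f),
      (M.submatrix id f).det * (N.submatrix f id).det := by
  classical
  -- Leibniz expansion of the minor of `M`; the sign of `σ` is absorbed by permuting the rows of
  -- `N`.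
  have hperm : ∀ f : Fin n → ι, (M.submatrix id f).det * (N.submatrix f id).det =
      ∑ σ : Equiv.Perm (Fin n),
        (∏ i, M i ((f ∘ σ) i)) * (N.submatrix (f ∘ σ) id).det := by
    intro f
    rw [← Matrix.det_transpose (M.submatrix id f), Matrix.det_apply', Finset.sum_mul]
    refine Finset.sum_congr rfl fun σ _ => ?_
    have := Matrix.det_permute σ (N.submatrix f id)
    rw [Matrix.submatrix_submatrix] at this
    rw [Function.id_comp] at this
    rw [this]
    simp only [Matrix.transpose_apply, Matrix.submatrix_apply, id, Function.comp]
    ring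
  simp_rw [hperm]
  rw [← Finset.sum_product', det_mul_eq_sum_prod_mul_det]
  symm
  -- An injective family is uniquely an increasing one composed with a permutation; a non-injective
  -- one repeats a row of `N` and contributes zero.
  refine Finset.sum_of_injOn (fun x => x.1 ∘ x.2) ?_ (by simp) ?_ (fun _ _ => rfl)
  · rintro ⟨f, σ⟩ hf ⟨f', σ'⟩ hf' h
    simp only [Finset.coe_product, Finset.coe_filter, Finset.mem_univ, true_and, Finset.coe_univ,
      Set.mem_prod, Set.mem_ofPred_eq, Set.mem_univ, and_true] at hf hf' h
    have hr : Set.range (key ∘ f) = Set.range (key ∘ f') := by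
      rw [← σ.surjective.range_comp (key ∘ f), ← σ'.surjective.range_comp (key ∘ f'),
        Function.comp_assoc, Function.comp_assoc, h]
    have hff : f = f' := hkey.comp_left (hf.range_inj hf' |>.mp hr)
    subst hff
    have hσ : σ = σ' := by
      ext i
      exact congrArg _ (hf.injective.of_comp (congrFun h i))
    rw [hσ]
  · intro f _ hf
    by_cases hinj : Function.Injective f
    · refine absurd ⟨(f ∘ Tuple.sort (key ∘ f), (Tuple.sort (key ∘ f))⁻¹), ?_, ?_⟩ hf
      · simp only [Finset.coe_product, Finset.coe_filter, Finset.mem_univ, true_and,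
          Finset.coe_univ, Set.mem_prod, Set.mem_ofPred_eq, Set.mem_univ, and_true]
        exact (Tuple.monotone_sort (key ∘ f)).strictMono_of_injective
          ((hkey.comp hinj).comp (Equiv.injective _))
      · ext i
        simp
    · rw [Function.not_injective_iff] at hinj
      obtain ⟨a, b, hab, hne⟩ := hinj
      rw [Matrix.det_zero_of_row_eq hne (by ext j; simp [hab]), mul_zero]

/-- Laplace expansion along the last row `e_i` leaves a single cofactor. -/
theorem wedge_eq_det_submatrix {n : ℕ} (v : Fin n → Fin (n + 1) → ℂ) (i : Fin (n + 1)) :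
    wedge (g := n + 1) v i =
      (-1) ^ (n + (i : ℕ)) * ((Matrix.of v).submatrix id i.succAbove).det := by
  unfold wedge
  rw [Matrix.det_succ_row _ (Fin.last n), Finset.sum_eq_single i]
  · simp only [Fin.val_last, Matrix.of_apply, Nat.add_sub_cancel, lt_self_iff_false, dite_false,
      Pi.single_eq_same, mul_one]
    congr 2
    ext a b
    simp [Matrix.submatrix_apply]
  · intro b _ hb
    simp [hb]
  · simp

/-- The adjugate of a weighted sum of squares `v_k v_kᵗ` of vectors. -/
theorem adjugate_sum_smul_vecMulVec {n : ℕ} {ι κ : Type*} [Fintype ι] [LinearOrder κ]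
    {key : ι → κ} (hkey : Function.Injective key) (d : ι → ℂ) (v : ι → Fin (n + 1) → ℂ)
    [DecidablePred fun f : Fin n → ι => StrictMono (key ∘ f)] :
    (∑ k, d k • Matrix.vecMulVec (v k) (v k)).adjugate =
      ∑ f : Fin n → ι with StrictMono (key ∘ f), (∏ i, d (f i)) •
        Matrix.vecMulVec (wedge (g := n + 1) fun i : Fin n => v (f i))
          (wedge (g := n + 1) fun i : Fin n => v (f i)) := by
  ext i j
  have hsub : (∑ k, d k • Matrix.vecMulVec (v k) (v k)).submatrix j.succAbove i.succAbove =
      (Matrix.of fun a k => v k (j.succAbove a)) *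
        (Matrix.of fun k b => d k * v k (i.succAbove b)) := by
    ext a b
    simp only [Matrix.submatrix_apply, Matrix.sum_apply, Matrix.smul_apply, Matrix.vecMulVec_apply,
      Matrix.mul_apply, Matrix.of_apply, smul_eq_mul]
    exact Finset.sum_congr rfl fun _ _ => by ring
  rw [Matrix.adjugate_fin_succ_eq_det_submatrix, hsub, det_mul_eq_sum_strictMono hkey,
    Finset.mul_sum, Matrix.sum_apply]
  refine Finset.sum_congr rfl fun f _ => ?_
  have hw := wedge_eq_det_submatrix fun a : Fin n => v (f a)
  rw [Matrix.smul_apply, Matrix.vecMulVec_apply, hw, hw, ← Matrix.det_transpose]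
  have h2 : ((Matrix.of fun k b => d k * v k (i.succAbove b)).submatrix f id).det =
      (∏ a, d (f a)) * ((Matrix.of fun a => v (f a)).submatrix id i.succAbove).det := by
    rw [← Matrix.det_mul_column]
    rfl
  have h3 : ((Matrix.of fun a k => v k (j.succAbove a)).submatrix id f)ᵀ =
      (Matrix.of fun a => v (f a)).submatrix id j.succAbove := by
    ext a b
    rfl
  -- The two wedge signs combine to the cofactor sign, since `(-1)^n` occurs twice.
  have h4 : ((-1 : ℂ) ^ (n + (i : ℕ)) * (-1) ^ (n + (j : ℕ))) = (-1) ^ ((j : ℕ) + i) := by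
    rw [← pow_add, show n + (i : ℕ) + (n + j) = 2 * n + (j + i) by ring, pow_add, pow_mul]
    simp
  rw [h2, h3, ← h4, smul_eq_mul]
  ring

/-! ### Exponential series with rapidly decaying coefficients -/

/-- The series `∑ c_p exp (u_p · z)`. -/
def expSeries {g : ℕ} {ι : Type*} (u : ι → Fin g → ℂ) (c : ι → ℂ) (z : Fin g → ℂ) : ℂ :=
  ∑' p, c p * Complex.exp (u p ⬝ᵥ z)

/-- The coefficients `c_p` decay faster than every exponential in the frequencies `u_p`. -/
def RapidDecay {g : ℕ} {ι : Type*} (u : ι → Fin g → ℂ) (c : ι → ℂ) : Prop :=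
  ∀ R : ℝ, Summable fun p => ‖c p‖ * Real.exp (R * ‖u p‖)

theorem norm_dotProduct_le {g : ℕ} (a b : Fin g → ℂ) : ‖a ⬝ᵥ b‖ ≤ g * ‖b‖ * ‖a‖ := by
  refine (norm_sum_le _ _).trans ?_
  calc ∑ i, ‖a i * b i‖ ≤ ∑ _i : Fin g, ‖b‖ * ‖a‖ := by
        refine Finset.sum_le_sum fun i _ => ?_
        rw [norm_mul, mul_comm]
        exact mul_le_mul (norm_le_pi_norm b i) (norm_le_pi_norm a i) (norm_nonneg _) (norm_nonneg _)
    _ = g * ‖b‖ * ‖a‖ := by simp [mul_assoc]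

theorem norm_exp_dotProduct_le {g : ℕ} (a b : Fin g → ℂ) :
    ‖Complex.exp (a ⬝ᵥ b)‖ ≤ Real.exp (g * ‖b‖ * ‖a‖) := by
  rw [Complex.norm_exp]
  exact Real.exp_le_exp.2 ((Complex.re_le_norm _).trans (norm_dotProduct_le a b))

namespace RapidDecay

variable {g : ℕ} {ι : Type*} {u : ι → Fin g → ℂ} {c : ι → ℂ}

theorem summable_norm (h : RapidDecay u c) (z : Fin g → ℂ) :
    Summable fun p => ‖c p * Complex.exp (u p ⬝ᵥ z)‖ := by
  refine Summable.of_nonneg_of_le (fun _ => norm_nonneg _) (fun p => ?_) (h (g * ‖z‖))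
  rw [norm_mul]
  exact mul_le_mul_of_nonneg_left (norm_exp_dotProduct_le _ _) (norm_nonneg _)

/-- The linear factor is absorbed by a larger `R`, because `x ≤ exp x`. This closes the class under
termwise differentiation. -/
theorem mul_dotProduct (h : RapidDecay u c) (w : Fin g → ℂ) :
    RapidDecay u fun p => c p * (u p ⬝ᵥ w) := by
  intro R
  refine Summable.of_nonneg_of_le (fun _ => by positivity) (fun p => ?_) (h (g * ‖w‖ + R))
  rw [norm_mul, add_mul, Real.exp_add, mul_assoc]
  gcongr
  exact (norm_dotProduct_le _ _).trans (by linarith [Real.add_one_le_exp (g * ‖w‖ * ‖u p‖)])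

theorem smul (h : RapidDecay u c) (k : ℂ) : RapidDecay (fun p => k • u p) c := by
  intro R
  simpa [norm_smul, mul_assoc] using h (R * ‖k‖)

theorem hasLineDerivAt (h : RapidDecay u c) (z w : Fin g → ℂ) :
    HasLineDerivAt ℂ (expSeries u c) (expSeries u (fun p => c p * (u p ⬝ᵥ w)) z) z w := by
  -- On the disc `‖t‖ < 1`, `‖z + t • w‖ ≤ ‖z‖ + ‖w‖` gives a majorant uniform in `t`.
  have key := hasDerivAt_tsum_of_isPreconnected
    (g := fun p (t : ℂ) => c p * Complex.exp (u p ⬝ᵥ (z + t • w)))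
    (g' := fun p t => c p * (u p ⬝ᵥ w) * Complex.exp (u p ⬝ᵥ (z + t • w)))
    (t := Metric.ball 0 1) (y₀ := 0) (y := 0)
    (h.mul_dotProduct w (g * (‖z‖ + ‖w‖))) Metric.isOpen_ball
    (convex_ball (0 : ℂ) 1).isPreconnected ?_ ?_ (by simp) ?_ (by simp)
  · simpa [HasLineDerivAt, expSeries] using key
  · intro p t _
    have h1 : HasDerivAt (fun t : ℂ => u p ⬝ᵥ (z + t • w)) (u p ⬝ᵥ w) t := by
      simp only [dotProduct_add, dotProduct_smul, smul_eq_mul]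
      simpa using ((hasDerivAt_id t).mul_const (u p ⬝ᵥ w)).const_add (u p ⬝ᵥ z)
    exact (h1.cexp.const_mul (c p)).congr_deriv (by ring)
  · intro p t ht
    rw [mem_ball_zero_iff] at ht
    rw [norm_mul]
    refine mul_le_mul_of_nonneg_left ((norm_exp_dotProduct_le _ _).trans ?_) (norm_nonneg _)
    gcongr
    refine (norm_add_le _ _).trans ?_
    rw [norm_smul]
    gcongr
    exact mul_le_of_le_one_left (norm_nonneg _) ht.le
  · simpa using (h.summable_norm z).of_norm

theorem partialZ_eq (h : RapidDecay u c) (i : Fin g) :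
    partialZ i (expSeries u c) = expSeries u fun p => c p * (u p ⬝ᵥ Pi.single i 1) :=
  funext fun z => (h.hasLineDerivAt z _).lineDeriv

theorem lineDifferentiableAt (h : RapidDecay u c) (z w : Fin g → ℂ) :
    LineDifferentiableAt ℂ (expSeries u c) z w :=
  (h.hasLineDerivAt z w).lineDifferentiableAt

theorem lineDifferentiableAt_partialZ (h : RapidDecay u c) (i : Fin g) (z w : Fin g → ℂ) :
    LineDifferentiableAt ℂ (partialZ i (expSeries u c)) z w := by
  rw [h.partialZ_eq]
  exact (h.mul_dotProduct _).lineDifferentiableAt z w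

/-- The Hessian of the square of an exponential series at a zero of the series. -/
theorem partialZ_partialZ_mul_self (h : RapidDecay u c) (i j : Fin g) {z : Fin g → ℂ}
    (hz : expSeries u c z = 0) :
    partialZ i (partialZ j fun x => expSeries u c x * expSeries u c x) z =
      2 * (partialZ i (expSeries u c) z * partialZ j (expSeries u c) z) := by
  have h1 : (partialZ j fun x => expSeries u c x * expSeries u c x) =
      fun x => 2 * (expSeries u c x * partialZ j (expSeries u c) x) := by
    funext x
    have hx := (h.lineDifferentiableAt x (Pi.single j 1)).hasLineDerivAt
    have := HasDerivAt.mul hx hx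
    simp only [zero_smul, add_zero] at this
    refine (HasDerivAt.deriv this).trans ?_
    simp only [partialZ]
    ring
  rw [h1]
  have hx := (h.lineDifferentiableAt z (Pi.single i 1)).hasLineDerivAt
  have hy := (h.lineDifferentiableAt_partialZ j z (Pi.single i 1)).hasLineDerivAt
  have := (HasDerivAt.mul hx hy).const_mul 2
  simp only [zero_smul, add_zero, hz] at this
  refine (HasDerivAt.deriv this).trans ?_
  simp only [partialZ]
  ring

end RapidDecay

theorem partialZ_sum_mul {g : ℕ} {κ : Type*} [Fintype κ] (i : Fin g) (k : κ → ℂ)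
    (f : κ → (Fin g → ℂ) → ℂ) (z : Fin g → ℂ)
    (hf : ∀ s, LineDifferentiableAt ℂ (f s) z (Pi.single i 1)) :
    partialZ i (fun x => ∑ s, k s * f s x) z = ∑ s, k s * partialZ i (f s) z :=
  HasDerivAt.deriv (HasDerivAt.fun_sum fun s _ =>
    HasDerivAt.const_mul (k s) (hf s).hasLineDerivAt)

/-! ### Gaussian sums over `ℤ^g` -/

/-- Every finite set of indices lies in a finite box, over which the sum factors. -/
theorem summable_prod_apply {ι κ : Type*} [Fintype ι] {f : κ → ℝ} (hf : Summable f)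
    (h0 : ∀ k, 0 ≤ f k) : Summable fun p : ι → κ => ∏ i, f (p i) := by
  classical
  refine summable_of_sum_le (c := ∏ _i : ι, ∑' k, f k) (fun p => Finset.prod_nonneg fun i _ => h0 _)
    fun s => ?_
  calc ∑ p ∈ s, ∏ i, f (p i)
      ≤ ∑ p ∈ Fintype.piFinset fun i => s.image fun p => p i, ∏ i, f (p i) := by
        refine Finset.sum_le_sum_of_subset_of_nonneg (fun p hp => ?_)
          fun p _ _ => Finset.prod_nonneg fun i _ => h0 _
        exact Fintype.mem_piFinset.2 fun i => Finset.mem_image_of_mem (fun p => p i) hp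
    _ = ∏ i, ∑ k ∈ s.image fun p => p i, f k := (Finset.prod_univ_sum _ _).symm
    _ ≤ ∏ _i : ι, ∑' k, f k :=
        Finset.prod_le_prod (fun i _ => Finset.sum_nonneg fun k _ => h0 k)
          fun i _ => hf.sum_le_tsum _ fun k _ => h0 k

theorem summable_exp_neg_abs_int : Summable fun n : ℤ => Real.exp (-|(n : ℝ)|) := by
  rw [summable_int_iff_summable_nat_and_neg]
  constructor <;> simpa using Real.summable_exp_neg_nat

theorem summable_exp_neg_mul_norm_int (g : ℕ) :
    Summable fun p : Fin g → ℤ => Real.exp (-(g * ‖p‖)) := by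
  refine Summable.of_nonneg_of_le (fun _ => (Real.exp_pos _).le) (fun p => ?_)
    (summable_prod_apply summable_exp_neg_abs_int fun _ => (Real.exp_pos _).le)
  rw [← Real.exp_sum, Real.exp_le_exp, Finset.sum_neg_distrib, neg_le_neg_iff]
  calc ∑ i, |(p i : ℝ)| ≤ ∑ _i : Fin g, ‖p‖ :=
        Finset.sum_le_sum fun i _ => norm_le_pi_norm p i
    _ = g * ‖p‖ := by simp

theorem exists_pos_mul_sq_norm_le {g : ℕ} {Y : Matrix (Fin g) (Fin g) ℝ} (hY : Y.PosDef) :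
    ∃ c > 0, ∀ x : Fin g → ℝ, c * ‖x‖ ^ 2 ≤ x ⬝ᵥ (Y *ᵥ x) := by
  have hpos : ∀ x : Fin g → ℝ, x ≠ 0 → 0 < x ⬝ᵥ (Y *ᵥ x) := fun x hx => by
    simpa using hY.dotProduct_mulVec_pos hx
  obtain hne | hne := (Metric.sphere (0 : Fin g → ℝ) 1).eq_empty_or_nonempty
  -- An empty unit sphere means that the space is zero.
  · refine ⟨1, one_pos, fun x => ?_⟩
    have : x = 0 := by
      by_contra hx
      have : ‖x‖⁻¹ • x ∈ Metric.sphere (0 : Fin g → ℝ) 1 := by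
        simp [norm_smul, norm_ne_zero_iff.2 hx]
      simp [hne] at this
    simp [this]
  · have hcont : Continuous fun x : Fin g → ℝ => x ⬝ᵥ (Y *ᵥ x) := by fun_prop
    obtain ⟨x₀, hx₀, hmin⟩ := (isCompact_sphere (0 : Fin g → ℝ) 1).exists_isMinOn hne
      hcont.continuousOn
    refine ⟨_, hpos x₀ (fun h => by simp [h] at hx₀), fun x => ?_⟩
    by_cases hx : x = 0
    · simp [hx]
    have hx' : 0 < ‖x‖ := norm_pos_iff.2 hx
    have := hmin (show ‖x‖⁻¹ • x ∈ Metric.sphere (0 : Fin g → ℝ) 1 by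
      simp [norm_smul, hx'.ne'])
    simp only [Set.mem_ofPred_eq, Matrix.mulVec_smul, dotProduct_smul, smul_dotProduct,
      smul_eq_mul] at this
    calc _ ≤ (‖x‖⁻¹ * (‖x‖⁻¹ * x ⬝ᵥ (Y *ᵥ x))) * ‖x‖ ^ 2 := by gcongr
      _ = _ := by field_simp

theorem summable_exp_neg_posDef {g : ℕ} {Y : Matrix (Fin g) (Fin g) ℝ} (hY : Y.PosDef)
    (h : Fin g → ℝ) (R : ℝ) :
    Summable fun p : Fin g → ℤ =>
      let x : Fin g → ℝ := (fun i => (p i : ℝ)) + h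
      Real.exp (-(Real.pi * x ⬝ᵥ (Y *ᵥ x))) * Real.exp (R * ‖x‖) := by
  obtain ⟨c, hc, hcY⟩ := exists_pos_mul_sq_norm_le hY
  have ha : 0 < Real.pi * c := mul_pos Real.pi_pos hc
  -- The first term of the constant is the maximum of `(R + g) s - π c s²`. The extra `g` buys the
  -- factor `exp (-g ‖p‖)`, and `g ‖h‖` pays for replacing `x` by `p`.
  refine Summable.of_nonneg_of_le (fun _ => by positivity) (fun p => ?_)
    ((summable_exp_neg_mul_norm_int g).mul_left
      (Real.exp ((R + g) ^ 2 / (4 * (Real.pi * c)) + g * ‖h‖)))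
  dsimp only
  set x : Fin g → ℝ := (fun i => (p i : ℝ)) + h
  have hp : ‖p‖ ≤ ‖x‖ + ‖h‖ := by
    have h1 : ‖p‖ = ‖fun i => (p i : ℝ)‖ := rfl
    rw [h1, show (fun i => (p i : ℝ)) = x - h by simp [x]]
    exact norm_sub_le _ _
  have h2 : (R + g) * ‖x‖ - Real.pi * c * ‖x‖ ^ 2 ≤ (R + g) ^ 2 / (4 * (Real.pi * c)) := by
    rw [le_div_iff₀ (by positivity)]
    nlinarith [sq_nonneg (2 * (Real.pi * c) * ‖x‖ - (R + g))]
  have h3 : Real.pi * c * ‖x‖ ^ 2 ≤ Real.pi * x ⬝ᵥ (Y *ᵥ x) := by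
    rw [mul_assoc]
    exact mul_le_mul_of_nonneg_left (hcY x) Real.pi_pos.le
  have h4 : (g : ℝ) * ‖p‖ ≤ g * (‖x‖ + ‖h‖) := by gcongr
  rw [← Real.exp_add, ← Real.exp_add, Real.exp_le_exp]
  nlinarith

/-! ### Signs -/

theorem sign2_zero : sign2 0 = 1 := by simp [sign2]

theorem sign2_one : sign2 1 = -1 := by simp [sign2, ZMod.val_one]

theorem zmod_two_eq_zero_or_one (x : ZMod 2) : x = 0 ∨ x = 1 := by
  revert x
  decide

theorem sign2_add (x y : ZMod 2) : sign2 (x + y) = sign2 x * sign2 y := by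
  obtain rfl | rfl := zmod_two_eq_zero_or_one x <;>
    obtain rfl | rfl := zmod_two_eq_zero_or_one y <;>
    simp [sign2_zero, sign2_one, CharTwo.add_self_eq_zero]

theorem sign2_sum {ι : Type*} (s : Finset ι) (f : ι → ZMod 2) :
    sign2 (∑ i ∈ s, f i) = ∏ i ∈ s, sign2 (f i) := by
  classical
  induction s using Finset.induction_on with
  | empty => simp [sign2_zero]
  | insert a s ha ih => rw [Finset.sum_insert ha, Finset.prod_insert ha, sign2_add, ih]

theorem exp_pi_mul_I_mul_intCast (k : ℤ) :
    Complex.exp (Real.pi * Complex.I * k) = sign2 (k : ZMod 2) := by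
  obtain ⟨m, rfl⟩ | ⟨m, rfl⟩ := k.even_or_odd
  · rw [show (Real.pi * Complex.I * ((m + m : ℤ) : ℂ)) = m * (2 * Real.pi * Complex.I) by
      push_cast; ring, Complex.exp_int_mul_two_pi_mul_I]
    push_cast
    rw [CharTwo.add_self_eq_zero, sign2_zero]
  · rw [show (Real.pi * Complex.I * ((2 * m + 1 : ℤ) : ℂ)) =
      m * (2 * Real.pi * Complex.I) + Real.pi * Complex.I by push_cast; ring, Complex.exp_add,
      Complex.exp_int_mul_two_pi_mul_I, Complex.exp_pi_mul_I]
    push_cast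
    rw [show (2 : ZMod 2) = 0 from rfl, zero_mul, zero_add, sign2_one, one_mul]

theorem sum_sign2_dotProduct {g : ℕ} (β : F2 g) :
    ∑ α : F2 g, sign2 (β ⬝ᵥ α) = if β = 0 then 2 ^ g else 0 := by
  split_ifs with h
  · simp [h, sign2_zero, ZMod.card]
  -- Translation by `e_i` with `β i = 1` reverses every sign.
  · obtain ⟨i, hi⟩ := Function.ne_iff.1 h
    have hi1 : β i = 1 := (zmod_two_eq_zero_or_one _).resolve_left hi
    have hs := Equiv.sum_comp (Equiv.addRight (Pi.single i 1 : F2 g))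
      fun α => sign2 (β ⬝ᵥ α)
    simp only [Equiv.coe_addRight, dotProduct_add, dotProduct_single, hi1, mul_one, sign2_add,
      sign2_one, mul_neg, Finset.sum_neg_distrib] at hs
    exact self_eq_neg.1 hs.symm

/-! ### Theta functions as exponential series -/

/-- The point `p + ε / 2` of the translate by `ε / 2` of the lattice `ℤ^g`. -/
def shift {g : ℕ} (ε : F2 g) (p : Fin g → ℤ) : Fin g → ℂ := (fun i => (p i : ℂ)) + half ε

/-- The coefficient of `exp (2 π i u · z)` in the theta series, where `u = p + ε / 2`. -/
def thetaCoeff {g : ℕ} (m : Characteristic g) (τ : Matrix (Fin g) (Fin g) ℂ) (p : Fin g → ℤ) : ℂ :=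
  Complex.exp (Real.pi * Complex.I *
    (shift m.1 p ⬝ᵥ (τ *ᵥ shift m.1 p) + 2 * (shift m.1 p ⬝ᵥ half m.2)))

theorem theta_eq_expSeries {g : ℕ} (m : Characteristic g) (τ : Matrix (Fin g) (Fin g) ℂ) :
    theta m τ = expSeries (fun p => (2 * Real.pi * Complex.I) • shift m.1 p) (thetaCoeff m τ) := by
  funext z
  refine tsum_congr fun p => ?_
  rw [thetaCoeff, ← Complex.exp_add, smul_dotProduct, smul_eq_mul]
  change Complex.exp (_ * (shift m.1 p ⬝ᵥ (τ *ᵥ shift m.1 p) + 2 * (shift m.1 p ⬝ᵥ _))) = _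
  rw [dotProduct_add]
  congr 1
  ring

theorem theta2_eq_expSeries {g : ℕ} (σ : F2 g) (τ : Matrix (Fin g) (Fin g) ℂ) :
    theta2 σ τ = expSeries (fun p => (2 : ℂ) • (2 * Real.pi * Complex.I) • shift σ p)
      (thetaCoeff (σ, 0) ((2 : ℂ) • τ)) := by
  funext z
  rw [theta2, theta_eq_expSeries]
  refine tsum_congr fun p => ?_
  rw [dotProduct_smul, smul_dotProduct 2]

theorem rapidDecay_theta {g : ℕ} (m : Characteristic g) {τ : Matrix (Fin g) (Fin g) ℂ}
    (hτ : (τ.map Complex.im).PosDef) :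
    RapidDecay (fun p => (2 * Real.pi * Complex.I) • shift m.1 p) (thetaCoeff m τ) := by
  intro R
  set h : Fin g → ℝ := fun i => ((m.1 i).val : ℝ) / 2 with hh
  refine (summable_exp_neg_posDef hτ h (R * (2 * Real.pi))).congr fun p => ?_
  set x : Fin g → ℝ := (fun i => (p i : ℝ)) + h with hx
  have hs : shift m.1 p = fun i => (x i : ℂ) := by
    funext i
    simp [shift, half, hx, hh, -ZMod.natCast_val]
  have hnorm : ‖shift m.1 p‖ = ‖x‖ := by
    rw [hs]
    simp [Pi.norm_def]
  have him : (shift m.1 p ⬝ᵥ (τ *ᵥ shift m.1 p) + 2 * (shift m.1 p ⬝ᵥ half m.2)).im =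
      x ⬝ᵥ (τ.map Complex.im *ᵥ x) := by
    have h1 : (shift m.1 p ⬝ᵥ half m.2).im = 0 := by
      rw [hs, show half m.2 = fun i => (((m.2 i).val / 2 : ℝ) : ℂ) by
        funext i; simp [half, -ZMod.natCast_val]]
      simp only [dotProduct, Complex.im_sum]
      exact Finset.sum_eq_zero fun i _ => by rw [← Complex.ofReal_mul, Complex.ofReal_im]
    rw [Complex.add_im, show ((2 : ℂ) * (shift m.1 p ⬝ᵥ half m.2)).im = 0 by simp [h1], add_zero,
      hs]
    simp only [dotProduct, Matrix.mulVec, Complex.im_sum, Complex.im_ofReal_mul,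
      Complex.im_mul_ofReal, Matrix.map_apply]
  rw [thetaCoeff, Complex.norm_exp, norm_smul, hnorm, mul_assoc (Real.pi : ℂ),
    Complex.re_ofReal_mul, Complex.I_mul_re, him]
  simp only [norm_mul, Complex.norm_I, Complex.norm_real, Complex.norm_ofNat, mul_one,
    Real.norm_of_nonneg Real.pi_pos.le]
  rw [mul_neg, mul_assoc]

theorem posDef_im_two_smul {g : ℕ} {τ : Matrix (Fin g) (Fin g) ℂ}
    (hτ : (τ.map Complex.im).PosDef) : (((2 : ℂ) • τ).map Complex.im).PosDef := by
  have : ((2 : ℂ) • τ).map Complex.im = (2 : ℝ) • τ.map Complex.im := by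
    ext i j
    simp
  rw [this]
  exact hτ.smul two_pos

theorem rapidDecay_theta2 {g : ℕ} (σ : F2 g) {τ : Matrix (Fin g) (Fin g) ℂ}
    (hτ : (τ.map Complex.im).PosDef) :
    RapidDecay (fun p => (2 : ℂ) • (2 * Real.pi * Complex.I) • shift σ p)
      (thetaCoeff (σ, 0) ((2 : ℂ) • τ)) :=
  (rapidDecay_theta (σ, 0) (posDef_im_two_smul hτ)).smul 2

/-! ### The addition formula -/

/-- The integral vectors `(p, q)` for which `(p + η/2, q + η/2) = (a + b, a - b)`, where
`a = k + ρ/2` and `b = l + (ρ + η)/2`. -/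
def pairIndex {g : ℕ} (η : F2 g) (y : F2 g × (Fin g → ℤ) × (Fin g → ℤ)) :
    (Fin g → ℤ) × (Fin g → ℤ) :=
  (fun i => y.2.1 i + y.2.2 i + ((y.1 i).val + (y.1 i + η i).val - (η i).val : ℤ) / 2,
    fun i => y.2.1 i - y.2.2 i + ((y.1 i).val - (y.1 i + η i).val - (η i).val : ℤ) / 2)

/-- In all four cases the numerators in `pairIndex` are even, so its integer divisions are exact. -/
theorem zmod_two_lift_cases (r e : ZMod 2) :
    (r = 0 ∧ r.val = 0 ∧ e.val = 0 ∧ (r + e).val = 0) ∨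
    (r = 0 ∧ r.val = 0 ∧ e.val = 1 ∧ (r + e).val = 1) ∨
    (r = 1 ∧ r.val = 1 ∧ e.val = 0 ∧ (r + e).val = 1) ∨
    (r = 1 ∧ r.val = 1 ∧ e.val = 1 ∧ (r + e).val = 0) := by
  revert r e
  decide

theorem bijective_pairIndex {g : ℕ} (η : F2 g) : Function.Bijective (pairIndex η) := by
  constructor
  · rintro ⟨ρ, k, l⟩ ⟨ρ', k', l'⟩ h
    simp only [pairIndex, Prod.mk.injEq, funext_iff] at h
    have key : ∀ i, ρ i = ρ' i ∧ k i = k' i ∧ l i = l' i := by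
      intro i
      have h1 := h.1 i
      have h2 := h.2 i
      obtain ⟨a1, a2, a3, a4⟩ | ⟨a1, a2, a3, a4⟩ | ⟨a1, a2, a3, a4⟩ | ⟨a1, a2, a3, a4⟩ :=
        zmod_two_lift_cases (ρ i) (η i) <;>
      obtain ⟨b1, b2, b3, b4⟩ | ⟨b1, b2, b3, b4⟩ | ⟨b1, b2, b3, b4⟩ | ⟨b1, b2, b3, b4⟩ :=
        zmod_two_lift_cases (ρ' i) (η i) <;>
      rw [a2, a3, a4, b2, b4] at h1 h2 <;> rw [a1, b1] <;>
      first
      | exact ⟨rfl, by omega, by omega⟩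
      | omega
    simp only [Prod.mk.injEq, funext_iff]
    exact ⟨fun i => (key i).1, fun i => (key i).2.1, fun i => (key i).2.2⟩
  · rintro ⟨p, q⟩
    -- Since `p + q + η = 2k + ρ` on lifts, `ρ` is the parity of `p + q + η`; then `k` and `l` are
    -- determined.
    have key : ∀ i, ∃ (r : ZMod 2) (k l : ℤ),
        k + l + ((r.val : ℤ) + (r + η i).val - (η i).val) / 2 = p i ∧
        k - l + ((r.val : ℤ) - (r + η i).val - (η i).val) / 2 = q i := by
      intro i
      obtain ⟨n, hn⟩ | ⟨n, hn⟩ := (p i + q i).even_or_odd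
      · obtain he | he := zmod_two_eq_zero_or_one (η i)
        · refine ⟨0, n, p i - n, ?_⟩
          simp [he]
          omega
        · refine ⟨1, n, p i - n, ?_⟩
          rw [he, show ((1 : ZMod 2) + 1).val = 0 from rfl, ZMod.val_one]
          omega
      · obtain he | he := zmod_two_eq_zero_or_one (η i)
        · refine ⟨1, n, p i - n - 1, ?_⟩
          rw [he, add_zero, ZMod.val_one, ZMod.val_zero]
          omega
        · refine ⟨0, n + 1, p i - n - 1, ?_⟩
          rw [he, zero_add, ZMod.val_one, ZMod.val_zero]
          omega
    choose r k l h1 h2 using key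
    exact ⟨(r, k, l), Prod.ext (funext h1) (funext h2)⟩

theorem shift_pairIndex_fst {g : ℕ} (η ρ : F2 g) (k l : Fin g → ℤ) :
    shift η (pairIndex η (ρ, k, l)).1 = shift ρ k + shift (ρ + η) l := by
  funext i
  simp only [shift, pairIndex, half, Pi.add_apply]
  obtain ⟨-, a2, a3, a4⟩ | ⟨-, a2, a3, a4⟩ | ⟨-, a2, a3, a4⟩ | ⟨-, a2, a3, a4⟩ :=
    zmod_two_lift_cases (ρ i) (η i) <;> rw [a2, a3, a4] <;> norm_num <;> ring

theorem shift_pairIndex_snd {g : ℕ} (η ρ : F2 g) (k l : Fin g → ℤ) :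
    shift η (pairIndex η (ρ, k, l)).2 = shift ρ k - shift (ρ + η) l := by
  funext i
  simp only [shift, pairIndex, half, Pi.add_apply, Pi.sub_apply]
  obtain ⟨-, a2, a3, a4⟩ | ⟨-, a2, a3, a4⟩ | ⟨-, a2, a3, a4⟩ | ⟨-, a2, a3, a4⟩ :=
    zmod_two_lift_cases (ρ i) (η i) <;> rw [a2, a3, a4] <;> norm_num <;> ring

theorem exp_shift_dotProduct_half {g : ℕ} (ρ α : F2 g) (k : Fin g → ℤ) :
    Complex.exp (Real.pi * Complex.I * (4 * (shift ρ k ⬝ᵥ half α))) = sign2 (ρ ⬝ᵥ α) := by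
  have h : 4 * (shift ρ k ⬝ᵥ half α) =
      ((∑ i, (2 * k i + (ρ i).val) * ((α i).val : ℤ) : ℤ) : ℂ) := by
    simp only [dotProduct, Finset.mul_sum, shift, half, Pi.add_apply]
    push_cast
    exact Finset.sum_congr rfl fun i _ => by ring
  rw [h, exp_pi_mul_I_mul_intCast]
  congr 1
  push_cast
  refine Finset.sum_congr rfl fun i _ => ?_
  rw [ZMod.natCast_zmod_val, ZMod.natCast_zmod_val, show (2 : ZMod 2) = 0 from rfl, zero_mul,
    zero_add]

/-- The summands of the theta series. -/
def thetaTerm {g : ℕ} (m : Characteristic g) (τ : Matrix (Fin g) (Fin g) ℂ) (z : Fin g → ℂ)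
    (p : Fin g → ℤ) : ℂ :=
  Complex.exp (Real.pi * Complex.I *
    (shift m.1 p ⬝ᵥ (τ *ᵥ shift m.1 p) + 2 * (shift m.1 p ⬝ᵥ (z + half m.2))))

theorem summable_norm_thetaTerm {g : ℕ} (m : Characteristic g) {τ : Matrix (Fin g) (Fin g) ℂ}
    (hτ : (τ.map Complex.im).PosDef) (z : Fin g → ℂ) :
    Summable fun p => ‖thetaTerm m τ z p‖ := by
  refine ((rapidDecay_theta m hτ).summable_norm z).congr fun p => ?_
  rw [thetaCoeff, thetaTerm, ← Complex.exp_add, smul_dotProduct, smul_eq_mul, dotProduct_add]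
  congr 2
  ring

/-- Parallelogram law: at `a + b` and `a - b` the quadratic terms add up to twice those at `a` and
`b`, while the linear terms involve `a` only. Hence `b` carries no `x`, and `α` leaves only a sign.
-/
theorem thetaTerm_mul_thetaTerm {g : ℕ} (η α ρ : F2 g) (τ : Matrix (Fin g) (Fin g) ℂ)
    (x : Fin g → ℂ) (k l : Fin g → ℤ) :
    thetaTerm (η, α) τ x (pairIndex η (ρ, k, l)).1 *
      thetaTerm (η, α) τ x (pairIndex η (ρ, k, l)).2 =
    sign2 (ρ ⬝ᵥ α) * (thetaTerm (ρ, 0) ((2 : ℂ) • τ) ((2 : ℂ) • x) k *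
      thetaTerm (ρ + η, 0) ((2 : ℂ) • τ) ((2 : ℂ) • 0) l) := by
  have h0 : half (0 : F2 g) = 0 := by
    funext i
    simp [half]
  rw [← exp_shift_dotProduct_half ρ α k]
  simp only [thetaTerm, shift_pairIndex_fst, shift_pairIndex_snd, h0, ← Complex.exp_add]
  generalize shift ρ k = a
  generalize shift (ρ + η) l = b
  simp only [Matrix.mulVec_add, Matrix.mulVec_sub, Matrix.smul_mulVec, add_dotProduct,
    sub_dotProduct, dotProduct_add, dotProduct_sub, dotProduct_smul, dotProduct_zero, smul_eq_mul]
  congr 1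
  ring

theorem theta_mul_self {g : ℕ} (η α : F2 g) {τ : Matrix (Fin g) (Fin g) ℂ}
    (hτ : (τ.map Complex.im).PosDef) (x : Fin g → ℂ) :
    theta (η, α) τ x * theta (η, α) τ x =
      ∑ ρ : F2 g, sign2 (ρ ⬝ᵥ α) * theta2 (ρ + η) τ 0 * theta2 ρ τ x := by
  have hτ2 := posDef_im_two_smul hτ
  have hs := summable_norm_thetaTerm (η, α) hτ x
  change (∑' p, thetaTerm (η, α) τ x p) * (∑' p, thetaTerm (η, α) τ x p) = _
  rw [tsum_mul_tsum_of_summable_norm hs hs,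
    ← (Equiv.ofBijective _ (bijective_pairIndex η)).tsum_eq]
  have hs2 := (summable_mul_of_summable_norm hs hs).comp_injective
    (bijective_pairIndex η).injective
  refine (Summable.tsum_prod hs2).trans ?_
  rw [tsum_fintype]
  refine Finset.sum_congr rfl fun ρ _ => ?_
  change (∑' y : (Fin g → ℤ) × (Fin g → ℤ), thetaTerm (η, α) τ x (pairIndex η (ρ, y.1, y.2)).1 *
      thetaTerm (η, α) τ x (pairIndex η (ρ, y.1, y.2)).2) = _ * (∑' p, thetaTerm _ _ _ p) *
        (∑' p, thetaTerm _ _ _ p)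
  simp_rw [thetaTerm_mul_thetaTerm]
  rw [tsum_mul_left, ← tsum_mul_tsum_of_summable_norm (summable_norm_thetaTerm _ hτ2 _)
    (summable_norm_thetaTerm _ hτ2 _)]
  ring

/-! ### Gradients of odd theta functions -/

theorem F2.add_self {g : ℕ} (a : F2 g) : a + a = 0 :=
  funext fun _ => CharTwo.add_self_eq_zero _

theorem F2.add_eq_zero_iff {g : ℕ} (a b : F2 g) : a + b = 0 ↔ a = b := by
  simp only [funext_iff, Pi.add_apply, Pi.zero_apply, CharTwo.add_eq_zero]

theorem F2.add_add_cancel_right {g : ℕ} (a b : F2 g) : a + b + b = a := by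
  rw [add_assoc, F2.add_self, add_zero]

/-- In the addition formula at `0`, `ρ ↦ ρ + η` swaps the two factors and flips the sign, so the
square equals its own negative. -/
theorem theta_zero_of_isOdd {g : ℕ} {η α : F2 g} (hodd : Characteristic.IsOdd (η, α))
    {τ : Matrix (Fin g) (Fin g) ℂ} (hτ : (τ.map Complex.im).PosDef) :
    theta (η, α) τ 0 = 0 := by
  have h := theta_mul_self η α hτ 0
  have hs := Equiv.sum_comp (Equiv.addRight η)
    fun ρ => sign2 (ρ ⬝ᵥ α) * theta2 (ρ + η) τ 0 * theta2 ρ τ 0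
  have hneg : ∀ ρ : F2 g, sign2 ((ρ + η) ⬝ᵥ α) * theta2 (ρ + η + η) τ 0 * theta2 (ρ + η) τ 0 =
      -(sign2 (ρ ⬝ᵥ α) * theta2 (ρ + η) τ 0 * theta2 ρ τ 0) := by
    intro ρ
    have h1 : η ⬝ᵥ α = 1 := hodd
    rw [F2.add_add_cancel_right, add_dotProduct, sign2_add, h1, sign2_one]
    ring
  simp only [Equiv.coe_addRight, hneg, Finset.sum_neg_distrib] at hs
  exact mul_self_eq_zero.1 (h.trans (self_eq_neg.1 hs.symm))

/-- Products of two coordinates of the gradient of an odd theta function, in terms of second order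
theta functions. -/
theorem two_mul_thetaGrad_mul_thetaGrad {g : ℕ} {η α : F2 g}
    (hodd : Characteristic.IsOdd (η, α)) {τ : Matrix (Fin g) (Fin g) ℂ}
    (hτ : (τ.map Complex.im).PosDef) (i j : Fin g) :
    2 * (thetaGrad (η, α) τ i * thetaGrad (η, α) τ j) =
      ∑ ρ : F2 g, sign2 (ρ ⬝ᵥ α) *
        (partialZ i (partialZ j (theta2 ρ τ)) 0 * theta2 (ρ + η) τ 0) := by
  have hz := theta_zero_of_isOdd hodd hτ
  have hsq := funext (theta_mul_self η α hτ)
  have hL := rapidDecay_theta (η, α) hτ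
  rw [theta_eq_expSeries] at hz hsq
  have hR := fun ρ : F2 g => rapidDecay_theta2 ρ hτ
  have h1 := hL.partialZ_partialZ_mul_self i j hz
  simp only [thetaGrad, theta_eq_expSeries]
  rw [← h1, hsq]
  have h2 : partialZ j (fun x => ∑ ρ : F2 g,
      sign2 (ρ ⬝ᵥ α) * theta2 (ρ + η) τ 0 * theta2 ρ τ x) =
      fun x => ∑ ρ : F2 g, sign2 (ρ ⬝ᵥ α) * theta2 (ρ + η) τ 0 * partialZ j (theta2 ρ τ) x :=
    funext fun z => partialZ_sum_mul j _ _ z fun ρ => by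
      rw [theta2_eq_expSeries]
      exact (hR ρ).lineDifferentiableAt z _
  rw [h2, partialZ_sum_mul i _ (fun ρ => partialZ j (theta2 ρ τ)) 0 fun ρ => by
    rw [theta2_eq_expSeries]
    exact (hR ρ).lineDifferentiableAt_partialZ j 0 _]
  exact Finset.sum_congr rfl fun ρ _ => by ring

/-- The matrix `A_{εδ}` as a signed sum of squares of gradients of odd theta functions. -/
theorem matA_eq_sum_vecMulVec {g : ℕ} (ε δ : F2 g) {τ : Matrix (Fin g) (Fin g) ℂ}
    (hτ : (τ.map Complex.im).PosDef) :
    matA ε δ τ = ∑ α : F2 g,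
      (if Characteristic.IsOdd (ε + δ, α) then 4 / 2 ^ g * sign2 (δ ⬝ᵥ α) else 0) •
        Matrix.vecMulVec (thetaGrad (ε + δ, α) τ) (thetaGrad (ε + δ, α) τ) := by
  ext i j
  set D : F2 g → ℂ := fun ρ => partialZ i (partialZ j (theta2 ρ τ)) 0
  set t : F2 g → ℂ := fun ρ => theta2 ρ τ 0
  -- The two signs differ by the factor `(-1)^{(ε+δ)·α}`: they cancel for even characteristics and
  -- reinforce for odd ones. The sum can thus run over all `α`, as orthogonality requires.
  have hterm : ∀ α : F2 g,
      (if Characteristic.IsOdd (ε + δ, α) then 4 / 2 ^ g * sign2 (δ ⬝ᵥ α) else 0) *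
        (thetaGrad (ε + δ, α) τ i * thetaGrad (ε + δ, α) τ j) =
      ∑ ρ : F2 g, (D ρ * t (ρ + (ε + δ)) / 2 ^ g) *
        (sign2 ((ρ + δ) ⬝ᵥ α) - sign2 ((ρ + ε) ⬝ᵥ α)) := by
    intro α
    have hsign : ∀ ρ : F2 g, sign2 ((ρ + ε) ⬝ᵥ α) =
        sign2 ((ρ + δ) ⬝ᵥ α) * sign2 ((ε + δ) ⬝ᵥ α) := by
      intro ρ
      rw [← sign2_add, ← add_dotProduct]
      congr 2
      rw [add_comm ε δ, add_assoc, ← add_assoc δ δ, F2.add_self, zero_add]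
    split_ifs with hodd
    · have h := two_mul_thetaGrad_mul_thetaGrad hodd hτ i j
      have h1 : (ε + δ) ⬝ᵥ α = 1 := hodd
      rw [show 4 / 2 ^ g * sign2 (δ ⬝ᵥ α) *
        (thetaGrad (ε + δ, α) τ i * thetaGrad (ε + δ, α) τ j) = 2 / 2 ^ g * sign2 (δ ⬝ᵥ α) *
        (2 * (thetaGrad (ε + δ, α) τ i * thetaGrad (ε + δ, α) τ j)) by ring, h, Finset.mul_sum]
      refine Finset.sum_congr rfl fun ρ _ => ?_
      rw [hsign, h1, sign2_one, add_dotProduct, sign2_add]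
      ring
    · have h0 : (ε + δ) ⬝ᵥ α = 0 := (zmod_two_eq_zero_or_one _).resolve_right hodd
      rw [zero_mul]
      symm
      refine Finset.sum_eq_zero fun ρ _ => ?_
      rw [hsign, h0, sign2_zero]
      ring
  have horth : ∀ σ ρ : F2 g, ∑ α : F2 g, sign2 ((ρ + σ) ⬝ᵥ α) = if ρ = σ then 2 ^ g else 0 := by
    intro σ ρ
    rw [sum_sign2_dotProduct]
    simp only [F2.add_eq_zero_iff]
  have h2g : (2 : ℂ) ^ g ≠ 0 := pow_ne_zero _ two_ne_zero
  simp only [Matrix.sum_apply, Matrix.smul_apply, Matrix.vecMulVec_apply, smul_eq_mul, hterm]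
  rw [Finset.sum_comm]
  -- Only `ρ = δ` and `ρ = ε` survive, giving the two terms of `matA`.
  simp_rw [← Finset.mul_sum, Finset.sum_sub_distrib, horth, mul_sub, Finset.sum_sub_distrib,
    mul_ite, mul_zero, Finset.sum_ite_eq', Finset.mem_univ, if_true, div_mul_cancel₀ _ h2g]
  rw [add_comm ε δ, ← add_assoc δ, F2.add_self, zero_add, add_comm δ ε,
    ← add_assoc ε, F2.add_self, zero_add]
  rfl

end ThetaGradients

end

/-- The sum runs over the sets `{α_1, …, α_{g-1}}` of distinct elements of `𝔽₂^g` with all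
`[ε + δ, α_j]` odd; each set is listed once, increasingly for an arbitrary numbering `idx` of
`𝔽₂^g`. -/
theorem mainTheorem4 {g : ℕ} (hg : 2 ≤ g) (ε δ : ThetaGradients.F2 g) (hεδ : ε ≠ δ)
    (idx : ThetaGradients.F2 g ≃ Fin (2 ^ g))
    (τ : Matrix (Fin g) (Fin g) ℂ) (hτ : τ ∈ ThetaGradients.siegelUpperHalfSpace g) :
    (ThetaGradients.matA ε δ τ).adjugate =
      ((Real.pi : ℂ) ^ 2 / 2 ^ (g - 2)) ^ (g - 1) •
        ∑ α : Fin (g - 1) → ThetaGradients.F2 g with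
            (∀ i j, i < j → idx (α i) < idx (α j)) ∧
              ∀ j, ThetaGradients.Characteristic.IsOdd (ε + δ, α j),
          ThetaGradients.sign2 (δ ⬝ᵥ ∑ j, α j) •
            ThetaGradients.formW (fun j => (ε + δ, α j)) τ := by
  classical
  obtain ⟨n, rfl⟩ := Nat.exists_eq_add_of_le' hg
  rw [ThetaGradients.matA_eq_sum_vecMulVec ε δ hτ.2,
    ThetaGradients.adjugate_sum_smul_vecMulVec (n := n + 1) idx.injective]
  conv_rhs => rw [← Finset.filter_filter, Finset.sum_filter, Finset.smul_sum]
  refine Finset.sum_congr (Finset.filter_congr fun α _ => ?_) fun α _ => ?_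
  · exact ⟨fun h i j hij => h hij, fun h i j hij => h i j hij⟩
  · split_ifs with hodd
    · have hodd' : ∀ a : Fin (n + 1),
        ThetaGradients.Characteristic.IsOdd (ε + δ, α a) := hodd
      have hpi : (Real.pi : ℂ) ≠ 0 := by exact_mod_cast Real.pi_ne_zero
      -- With `g = n + 2`, the powers of `π` cancel and `4 / 2^g = 1 / 2^n`.
      have hconst : ((Real.pi : ℂ) ^ 2 / 2 ^ n) ^ (n + 1) *
          (Real.pi : ℂ) ^ (-2 * ((n + 2 : ℕ) : ℤ) + 2) = (4 / 2 ^ (n + 2)) ^ (n + 1) := by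
        rw [show -2 * ((n + 2 : ℕ) : ℤ) + 2 = -((2 * (n + 1) : ℕ) : ℤ) by push_cast; ring,
          zpow_neg, zpow_natCast, div_pow, ← pow_mul,
          show (4 : ℂ) / 2 ^ (n + 2) = 1 / 2 ^ n by rw [pow_add]; field_simp; norm_num, div_pow,
          one_pow]
        field_simp
      have hprod : ∏ a : Fin (n + 1), (if ThetaGradients.Characteristic.IsOdd (ε + δ, α a) then
          4 / 2 ^ (n + 2) * ThetaGradients.sign2 (δ ⬝ᵥ α a) else 0) =
          (4 / 2 ^ (n + 2)) ^ (n + 1) *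
            ThetaGradients.sign2 (δ ⬝ᵥ ∑ a : Fin (n + 1), α a) := by
        rw [Finset.prod_congr rfl fun a _ => if_pos (hodd' a), Finset.prod_mul_distrib, Finset.prod_const, Finset.card_univ, Fintype.card_fin,
          dotProduct_sum, ThetaGradients.sign2_sum]
      refine (congrArg (· • _) hprod).trans ?_
      rw [← hconst, ThetaGradients.formW, smul_smul, smul_smul, mul_right_comm]
      rfl
    -- A single even characteristic makes the weight of the family zero.
    · obtain ⟨a, ha⟩ := not_forall.1 hodd
      have hprod : ∏ b : Fin (n + 1), (if ThetaGradients.Characteristic.IsOdd (ε + δ, α b) then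
          4 / 2 ^ (n + 2) * ThetaGradients.sign2 (δ ⬝ᵥ α b) else 0) = 0 :=
        Finset.prod_eq_zero (Finset.mem_univ (a : Fin (n + 1))) (if_neg ha)
      exact (congrArg (· • _) hprod).trans (by rw [zero_smul, smul_zero])
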